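/- Let $n$ and $k$ be integers with $n/2<k<n$. Call a finite sequence of elements of $\mathbb{Z}_n=\mathbb{Z}/n\mathbb{Z}$ (with repetitions allowed and the order of terms disregarded) $n$-zero-free if it has no subsequence of length exactly $n$ whose sum is $0$ in $\mathbb{Z}_n$. Then every $n$-zero-free sequence of length $n-1+k$ in $\mathbb{Z}_n$ contains two distinct elements $a\neq b$ the sum of whose multiplicities in the sequence is at least $2k$. This bound is best possible for every such $n$ and $k$: there is an $n$-zero-free sequence of length $n-1+k$ in $\mathbb{Z}_n$ in which any two distinct elements have multiplicities with sum at most $2k$. -/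

import Mathlib

/-- Finite sequences in `ZMod n`, considered up to rearrangement of terms, are multisets; the
subsequences of `γ` are the multisets `τ ≤ γ`. A sequence is `n`-zero-free if it has no
subsequence of length exactly `n` whose sum is zero in `ZMod n`. -/
def NZeroFree (n : ℕ) (γ : Multiset (ZMod n)) : Prop :=
  ∀ τ : Multiset (ZMod n), τ ≤ γ → τ.card = n → τ.sum ≠ 0

/-! Translation preserves `n`-zero-freeness, so let `0` be a most frequent term, of multiplicity
`u`. Let `W` be a longest zero-sum subsequence of the nonzero terms and `F` the rest, which is
zero-free.

Scherk's theorem yields short zero-sum subsequences, at most `u` long, which zeros can replace. So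
no zero-sum subsequence has length `n` or more, whence `u + |W| < n` and `|F| ≥ k > n/2`. A
zero-free sequence this long is made of multiples `m • g` with `∑ m` below the order of `g`
(`ZeroFree.exists_eq_map_nsmul`). That order exceeds `n/2`, so `g` generates, and one may take `g =
1`.

As `W` is longest, no part of it can be traded for a longer part of `F` with the same sum. This
forces `W` to consist of ones and of terms `-y` with `∑ y < n - ∑ m`. Since `W` has sum zero, it has
exactly `∑ y` ones; `F` has at least `2|F| - ∑ m`. Adding up gives `u + count 1 ≥ 2k`.

Sharpness is shown by `0^u 1^v 2^r (-1)^t`. -/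

/-- The set of sums of all subsequences, the empty one included. -/
def subsums {G : Type*} [AddCommGroup G] [DecidableEq G] (S : Multiset G) : Finset G :=
  (S.powerset.map Multiset.sum).toFinset

/-- No nonempty subsequence has sum zero. -/
def ZeroFree {G : Type*} [AddCommGroup G] (S : Multiset G) : Prop :=
  ∀ t ≤ S, t.sum = 0 → t = 0

theorem ZeroFree.mono {G : Type*} [AddCommGroup G] {S T : Multiset G} (hT : ZeroFree T)
    (h : S ≤ T) : ZeroFree S :=
  fun t ht => hT t (ht.trans h)

/-! ### Long zero-free sequences -/

section Structure

variable {G : Type*} [AddCommGroup G] [DecidableEq G]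

theorem mem_subsums {S : Multiset G} {x : G} : x ∈ subsums S ↔ ∃ t ≤ S, t.sum = x := by
  simp [subsums]

theorem subsums_cons (x : G) (S : Multiset G) :
    subsums (x ::ₘ S) = subsums S ∪ (subsums S).image (x + ·) := by
  ext y
  simp only [subsums, Multiset.powerset_cons, Multiset.map_add, Multiset.map_map,
    Multiset.toFinset_add, Finset.mem_union, Finset.mem_image, Multiset.mem_toFinset,
    Multiset.mem_map, Multiset.mem_powerset, Function.comp_apply, Multiset.sum_cons,
    exists_exists_and_eq_and]

theorem zero_mem_subsums (S : Multiset G) : 0 ∈ subsums S :=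
  mem_subsums.2 ⟨0, Multiset.zero_le _, rfl⟩

/-- Passing to the complementary subsequence reflects the set of sums. -/
theorem sub_mem_subsums {S : Multiset G} {x : G} (hx : x ∈ subsums S) :
    S.sum - x ∈ subsums S := by
  obtain ⟨t, ht, rfl⟩ := mem_subsums.1 hx
  refine mem_subsums.2 ⟨S - t, Multiset.sub_le_self _ _, ?_⟩
  rw [eq_sub_iff_add_eq, ← Multiset.sum_add, Multiset.sub_add_cancel ht]

theorem ZeroFree.add_ne_zero {S : Multiset G} {x y : G} (h : ZeroFree (x ::ₘ S))
    (hy : y ∈ subsums S) : x + y ≠ 0 := by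
  obtain ⟨t, ht, rfl⟩ := mem_subsums.1 hy
  intro h0
  exact Multiset.cons_ne_zero (h (x ::ₘ t) ((Multiset.cons_le_cons_iff x).2 ht) (by simpa using h0))

theorem ZeroFree.sum_notMem_subsums {S : Multiset G} {x : G} (h : ZeroFree (x ::ₘ S)) :
    x + S.sum ∉ subsums S := fun hm =>
  h.add_ne_zero (sub_mem_subsums hm) (by abel)

theorem ZeroFree.card_subsums_lt {S : Multiset G} {x : G} (h : ZeroFree (x ::ₘ S)) :
    (subsums S).card < (subsums (x ::ₘ S)).card := by
  apply Finset.card_lt_card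
  refine ⟨by rw [subsums_cons]; exact Finset.subset_union_left, fun hs => ?_⟩
  exact h.sum_notMem_subsums (hs (mem_subsums.2 ⟨_, le_rfl, by simp⟩))

/-- If adjoining `x` to `S` creates a single new subsequence sum, that sum is the total. -/
theorem ZeroFree.subsums_eq_insert {S : Multiset G} {x : G} (h : ZeroFree (x ::ₘ S))
    (hc : (subsums (x ::ₘ S)).card ≤ (subsums S).card + 1) :
    subsums (x ::ₘ S) = insert (x ::ₘ S).sum (subsums S) := by
  symm
  apply Finset.eq_of_subset_of_card_le
  · apply Finset.insert_subset (mem_subsums.2 ⟨_, le_rfl, rfl⟩)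
    rw [subsums_cons]
    exact Finset.subset_union_left
  · rw [Finset.card_insert_of_notMem]
    · exact hc
    · simpa using h.sum_notMem_subsums

/-- Reflect twice: `y ≠ 0` goes to a sum of `x ::ₘ S` other than the total, hence to a sum of `S`,
and reflecting within `S` gives `y - x`. -/
theorem sub_mem_of_subsums_eq_insert {S : Multiset G} {x : G}
    (h : subsums (x ::ₘ S) = insert (x ::ₘ S).sum (subsums S)) {y : G}
    (hy : y ∈ subsums (x ::ₘ S)) (hy0 : y ≠ 0) : y - x ∈ subsums S := by
  have h1 := sub_mem_subsums hy
  rw [h, Finset.mem_insert] at h1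
  rcases h1 with h1 | h1
  · exact absurd (by simpa using h1) hy0
  · have := sub_mem_subsums h1
    convert! this using 1
    rw [Multiset.sum_cons]
    abel

/-- All terms that create a single new subsequence sum are equal. -/
theorem ZeroFree.eq_of_card_subsums {S S₁ S₂ : Multiset G} {x y : G} (h : ZeroFree S)
    (hx : S = x ::ₘ S₁) (hy : S = y ::ₘ S₂)
    (hcx : (subsums S).card ≤ (subsums S₁).card + 1)
    (hcy : (subsums S).card ≤ (subsums S₂).card + 1) : x = y := by
  have ex : subsums S = insert S.sum (subsums S₁) := by
    rw [hx] at h hcx ⊢; exact h.subsums_eq_insert hcx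
  have ey : subsums S = insert S.sum (subsums S₂) := by
    rw [hy] at h hcy ⊢; exact h.subsums_eq_insert hcy
  have nx : S.sum ∉ subsums S₁ := by
    have := h; rw [hx] at this ⊢; simpa using this.sum_notMem_subsums
  have ny : S.sum ∉ subsums S₂ := by
    have := h; rw [hy] at this ⊢; simpa using this.sum_notMem_subsums
  have e12 : subsums S₁ = subsums S₂ := by
    rw [← Finset.erase_insert nx, ← ex, ey, Finset.erase_insert ny]
  have hxy : x ∈ subsums S := mem_subsums.2 ⟨{x}, by rw [hx]; simp, by simp⟩
  have hx0 : x ≠ 0 := by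
    have := h; rw [hx] at this; simpa using this.add_ne_zero (zero_mem_subsums _)
  -- If `x ≠ y`, subtracting `y` and then `x` from the sum `x` puts `-y` in `subsums S₁ = subsums
  -- S₂`, against zero-freeness.
  have h1 : x - y ∈ subsums S₂ := by
    subst hy
    exact sub_mem_of_subsums_eq_insert ey hxy hx0
  by_contra hne
  have h2 : x - y ∈ subsums S := by rw [ey]; exact Finset.mem_insert_of_mem h1
  have h3 : x - y - x ∈ subsums S₁ := by
    have := ex
    rw [hx] at this h2
    exact sub_mem_of_subsums_eq_insert this h2 (sub_ne_zero.2 hne)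
  rw [e12] at h3
  have h4 := h
  rw [hy] at h4
  exact h4.add_ne_zero h3 (by abel)

/-- A zero-free sequence with few subsequence sums consists of multiples `m • g` of one element,
the positive integers `m` having a sum smaller than the order of `g`. -/
theorem ZeroFree.exists_eq_map_nsmul (S : Multiset G) (h : ZeroFree S)
    (hc : (subsums S).card + 1 ≤ 2 * S.card) :
    ∃ (g : G) (M : Multiset ℕ), (∀ m ∈ M, 0 < m) ∧ S = M.map (· • g) ∧
      (∀ j, 0 < j → j ≤ M.sum → j • g ≠ 0) ∧
      subsums S = (Finset.range (M.sum + 1)).image (· • g) := by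
  induction S using Multiset.strongInductionOn with
  | ih S ih =>
  -- A term whose removal loses at least two sums can be dropped without breaking `hc`; if there is
  -- none, all terms coincide.
  by_cases hall : ∀ x S', S = x ::ₘ S' → (subsums S).card ≤ (subsums S').card + 1
  · -- all terms are equal
    obtain ⟨g, hg⟩ : ∃ g, ∀ x ∈ S, x = g := by
      rcases S.empty_or_exists_mem with rfl | ⟨g, hg⟩
      · exact ⟨0, by simp⟩
      · refine ⟨g, fun x hx => ?_⟩
        exact h.eq_of_card_subsums (Multiset.cons_erase hx).symm (Multiset.cons_erase hg).symm
          (hall _ _ (Multiset.cons_erase hx).symm) (hall _ _ (Multiset.cons_erase hg).symm)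
    have hS : S = Multiset.replicate S.card g := Multiset.eq_replicate_card.2 hg
    refine ⟨g, Multiset.replicate S.card 1, ?_, ?_, ?_, ?_⟩
    · intro m hm
      rw [Multiset.eq_of_mem_replicate hm]
      exact one_pos
    · rw [Multiset.map_replicate, one_smul]; exact hS
    · intro j hj hjS h0
      have hle : Multiset.replicate j g ≤ S := by
        rw [hS]; exact Multiset.replicate_mono _ (by simpa using hjS)
      have := h _ hle (by simpa using h0)
      have := congrArg Multiset.card this
      simp at this
      omega
    · ext y
      simp only [mem_subsums, Finset.mem_image, Finset.mem_range, Multiset.sum_replicate,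
        smul_eq_mul, mul_one]
      constructor
      · rintro ⟨t, ht, rfl⟩
        refine ⟨t.card, Nat.lt_succ_of_le (Multiset.card_le_card ht), ?_⟩
        rw [← Multiset.sum_replicate, ← Multiset.eq_replicate_card.2
          fun x hx => hg x (Multiset.mem_of_le ht hx)]
      · rintro ⟨j, hj, rfl⟩
        refine ⟨Multiset.replicate j g, ?_, by simp⟩
        rw [hS]
        exact Multiset.replicate_mono _ (by omega)
  · push Not at hall
    obtain ⟨x, S', rfl, hlt⟩ := hall
    obtain ⟨g, M, hpos, hS', hord, hsub⟩ := ih S' (Multiset.lt_cons_self _ _)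
      (h.mono (Multiset.le_cons_self _ _)) (by rw [Multiset.card_cons] at hc; omega)
    have hcard : S'.card ≤ M.sum := by
      rw [hS', Multiset.card_map]
      simpa using Multiset.card_nsmul_le_sum (a := 1) (s := M) fun m hm => hpos m hm
    have hmem : ∀ y, y ∈ subsums S' ↔ ∃ j, j ≤ M.sum ∧ j • g = y := by
      intro y
      rw [hsub]
      simp
    -- the translate of the old sums meets the old sums
    have hmeet : ∃ i ≤ M.sum, ∃ j ≤ M.sum, i • g = x + j • g := by
      by_contra hno
      push Not at hno
      have hdisj : Disjoint (subsums S') ((subsums S').image (x + ·)) := by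
        rw [Finset.disjoint_left]
        intro y hy hy'
        obtain ⟨i, hi, rfl⟩ := (hmem y).1 hy
        obtain ⟨z, hz, hzy⟩ := Finset.mem_image.1 hy'
        obtain ⟨j, hj, rfl⟩ := (hmem z).1 hz
        exact hno i hi j hj hzy.symm
      have hinj : (subsums S').card = M.sum + 1 := by
        rw [hsub, Finset.card_image_of_injOn, Finset.card_range]
        intro i hi j hj hij
        simp only [Finset.coe_range, Set.mem_Iio] at hi hj
        by_contra hne
        rcases Nat.lt_or_gt_of_ne hne with hlt | hlt
        · exact hord (j - i) (by omega) (by omega) (by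
            rw [sub_nsmul g hlt.le]; simpa [sub_eq_zero, ← sub_eq_add_neg] using hij.symm)
        · exact hord (i - j) (by omega) (by omega) (by
            rw [sub_nsmul g hlt.le]; simpa [sub_eq_zero, ← sub_eq_add_neg] using hij)
      -- Disjointness would give `2 * (M.sum + 1) ≥ 2 * (S'.card + 1)` sums, more than `hc` allows.
      rw [subsums_cons, Finset.card_union_of_disjoint hdisj,
        Finset.card_image_of_injective _ (add_right_injective x), hinj, Multiset.card_cons] at hc
      omega
    obtain ⟨i, hi, j, hj, hij⟩ := hmeet
    have hji : j < i := by
      by_contra hle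
      obtain ⟨d, rfl⟩ := Nat.exists_eq_add_of_le (not_lt.1 hle)
      refine h.add_ne_zero ((hmem (d • g)).2 ⟨d, by omega, rfl⟩) ?_
      rw [add_nsmul] at hij
      have : i • g + (x + d • g) = i • g + 0 := by rw [add_zero, add_left_comm]; exact hij.symm
      exact add_left_cancel this
    obtain ⟨d, rfl⟩ := Nat.exists_eq_add_of_le hji.le
    have hx : x = d • g := by
      rw [add_nsmul, add_comm] at hij
      exact (add_right_cancel hij).symm
    subst hx
    refine ⟨g, d ::ₘ M, ?_, by rw [Multiset.map_cons, ← hS'], ?_, ?_⟩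
    · intro m hm
      rcases Multiset.mem_cons.1 hm with rfl | hm
      · omega
      · exact hpos m hm
    · intro t ht htM
      rw [Multiset.sum_cons] at htM
      by_cases htM' : t ≤ M.sum
      · exact hord t ht htM'
      · obtain ⟨e, rfl⟩ := Nat.exists_eq_add_of_le (show d ≤ t by omega)
        rw [add_nsmul]
        exact h.add_ne_zero ((hmem _).2 ⟨e, by omega, rfl⟩)
    · rw [subsums_cons]
      ext y
      simp only [Finset.mem_union, Finset.mem_image, Finset.mem_range, Multiset.sum_cons, hmem]
      constructor
      · rintro (⟨t, ht, rfl⟩ | ⟨_, ⟨t, ht, rfl⟩, rfl⟩)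
        · exact ⟨t, by omega, rfl⟩
        · exact ⟨d + t, by omega, add_nsmul _ _ _⟩
      · rintro ⟨t, ht, rfl⟩
        by_cases htM : t ≤ M.sum
        · exact Or.inl ⟨t, htM, rfl⟩
        · obtain ⟨e, rfl⟩ := Nat.exists_eq_add_of_le (show d ≤ t by omega)
          exact Or.inr ⟨_, ⟨e, by omega, rfl⟩, (add_nsmul _ _ _).symm⟩

end Structure

/-! ### Scherk's theorem and short zero-sum subsequences -/

section Scherk

open scoped Pointwise

variable {G : Type*} [AddCommGroup G] [DecidableEq G]

/-- **Scherk's theorem**: if `0` is represented in `A + B` only as `0 + 0`, then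
`|A + B| ≥ |A| + |B| - 1`. -/
theorem card_add_card_le_card_add_of_unique_zero (B : Finset G) : ∀ A : Finset G, 0 ∈ A → 0 ∈ B →
    (∀ a ∈ A, ∀ b ∈ B, a + b = 0 → a = 0 ∧ b = 0) → A.card + B.card ≤ (A + B).card + 1 := by
  induction B using Finset.strongInduction with
  | H B ih =>
  intro A hA hB huniq
  by_cases hall : ∀ e ∈ A, ∀ b ∈ B, e + b ∈ A
  · have hB1 : ∀ b ∈ B, b = 0 := by
      intro b hb
      have himg : A.image (· + b) = A := by
        apply Finset.eq_of_subset_of_card_le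
        · intro y hy
          obtain ⟨a, ha, rfl⟩ := Finset.mem_image.1 hy
          exact hall a ha b hb
        · rw [Finset.card_image_of_injective _ (add_left_injective b)]
      rw [← himg] at hA
      obtain ⟨a, ha, hab⟩ := Finset.mem_image.1 hA
      exact (huniq a ha b hb hab).2
    have hB2 : B = {0} := Finset.eq_singleton_iff_unique_mem.2 ⟨hB, hB1⟩
    subst hB2
    simp
  · push Not at hall
    obtain ⟨e, he, b, hb, heb⟩ := hall
    -- Dyson's e-transform: it keeps `|A| + |B|` and the uniqueness of `0`, does not enlarge the
    -- sumset, and shrinks `B`.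
    set A' := A ∪ B.image (e + ·) with hA'
    set B' := B.filter (e + · ∈ A) with hB'
    have hlt : B' ⊂ B := Finset.filter_ssubset.2 ⟨b, hb, heb⟩
    have hcard : A'.card + B'.card = A.card + B.card := by
      have h1 := Finset.card_union_add_card_inter A (B.image (e + ·))
      have h2 : (A ∩ B.image (e + ·)).card = B'.card := by
        rw [← Finset.card_image_of_injective B' (add_right_injective e)]
        congr 1
        ext y
        simp only [Finset.mem_inter, Finset.mem_image, hB', Finset.mem_filter]
        constructor
        · rintro ⟨hy, c, hc, rfl⟩
          exact ⟨c, ⟨hc, hy⟩, rfl⟩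
        · rintro ⟨c, ⟨hc, hy⟩, rfl⟩
          exact ⟨hy, c, hc, rfl⟩
      rw [Finset.card_image_of_injective B (add_right_injective e), h2] at h1
      exact h1
    have hsub : A' + B' ⊆ A + B := by
      intro y hy
      obtain ⟨a, ha, c, hc, rfl⟩ := Finset.mem_add.1 hy
      obtain ⟨hc1, hc2⟩ := Finset.mem_filter.1 hc
      rcases Finset.mem_union.1 ha with ha | ha
      · exact Finset.add_mem_add ha hc1
      · obtain ⟨d, hd, rfl⟩ := Finset.mem_image.1 ha
        refine Finset.mem_add.2 ⟨e + c, hc2, d, hd, by abel⟩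
    have := ih B' hlt A' (Finset.mem_union_left _ hA)
      (Finset.mem_filter.2 ⟨hB, by simpa using he⟩) (by
        intro a ha c hc hac
        obtain ⟨hc1, hc2⟩ := Finset.mem_filter.1 hc
        rcases Finset.mem_union.1 ha with ha | ha
        · exact huniq a ha c hc1 hac
        · obtain ⟨d, hd, rfl⟩ := Finset.mem_image.1 ha
          have h1 := huniq (e + c) hc2 d hd (by rw [← hac]; abel)
          have h2 := huniq e he c hc1 h1.1
          simp [h1.2, h2.1, h2.2])
    have := Finset.card_le_card hsub
    omega

/-- If `R` has multiplicities at most `h` and no nonempty zero-sum subsequence of length at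
most `h`, then it has at least `1 + |R|` sums of subsequences of length at most `h`. -/
theorem exists_finset_short_sums (h : ℕ) : ∀ R : Multiset G, (∀ x, R.count x ≤ h) →
    (∀ t ≤ R, t.card ≤ h → t.sum = 0 → t = 0) →
    ∃ B : Finset G, 0 ∈ B ∧ R.card + 1 ≤ B.card ∧ ∀ b ∈ B, ∃ t ≤ R, t.card ≤ h ∧ t.sum = b := by
  induction h with
  | zero =>
    intro R hR _
    have : R = 0 := Multiset.eq_zero_of_forall_notMem fun x hx => by
      have := Multiset.count_pos.2 hx
      have := hR x
      omega
    subst this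
    exact ⟨{0}, by simp, by simp, by simp⟩
  | succ h ih =>
    intro R hR hfree
    have hle : R.dedup ≤ R := Multiset.dedup_le R
    obtain ⟨B, hB0, hBc, hB⟩ := ih (R - R.dedup) (fun x => by
        rw [Multiset.count_sub, Multiset.count_dedup]
        have := hR x
        split_ifs with hx
        · omega
        · rw [Multiset.count_eq_zero_of_notMem hx]; omega)
      (fun t ht htc => hfree t (ht.trans (Multiset.sub_le_self _ _)) (by omega))
    have hext : ∀ t ≤ R - R.dedup, ∀ z ∈ R.dedup, z ::ₘ t ≤ R := by
      intro t ht z hz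
      rw [← Multiset.singleton_add, ← Multiset.sub_add_cancel hle, add_comm]
      exact add_le_add ht (Multiset.singleton_le.2 hz)
    have h0 : (0 : G) ∉ R.toFinset := by
      intro h0
      have := hfree {0} (by simpa using h0) (by simp) (by simp)
      simp at this
    -- One copy of each distinct term is set aside, so each sum in `B` can take one more term;
    -- Scherk's bound gains the number of distinct terms.
    refine ⟨B + insert 0 R.toFinset, ?_, ?_, ?_⟩
    · exact Finset.mem_add.2 ⟨0, hB0, 0, Finset.mem_insert_self _ _, by simp⟩
    · have := card_add_card_le_card_add_of_unique_zero (insert 0 R.toFinset) B hB0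
        (Finset.mem_insert_self _ _) (by
          intro b hb z hz hbz
          rcases Finset.mem_insert.1 hz with rfl | hz
          · exact ⟨by simpa using hbz, rfl⟩
          · obtain ⟨t, ht, htc, rfl⟩ := hB b hb
            have := hfree (z ::ₘ t) (hext t ht z (by simpa using hz)) (by simpa using htc)
              (by rw [Multiset.sum_cons, add_comm, hbz])
            simp at this)
      rw [Finset.card_insert_of_notMem h0, Multiset.card_toFinset] at this
      rw [Multiset.card_sub hle] at hBc
      have := Multiset.card_le_card hle
      omega
    · intro y hy
      obtain ⟨b, hb, z, hz, rfl⟩ := Finset.mem_add.1 hy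
      obtain ⟨t, ht, htc, rfl⟩ := hB b hb
      rcases Finset.mem_insert.1 hz with rfl | hz
      · exact ⟨t, ht.trans (Multiset.sub_le_self _ _), by omega, by simp⟩
      · exact ⟨z ::ₘ t, hext t ht z (by simpa using hz), by simpa using htc,
          by rw [Multiset.sum_cons, add_comm]⟩

/-- A sequence of length at least `|G|` with multiplicities at most `h` has a nonempty zero-sum
subsequence of length at most `h`. -/
theorem exists_short_zero_sum [Fintype G] {h : ℕ} {R : Multiset G} (hR : ∀ x, R.count x ≤ h)
    (hcard : Fintype.card G ≤ R.card) : ∃ t ≤ R, t.card ≤ h ∧ t.sum = 0 ∧ t ≠ 0 := by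
  by_contra hno
  push Not at hno
  obtain ⟨B, -, hB, -⟩ := exists_finset_short_sums h R hR hno
  have := Finset.card_le_univ B
  omega

end Scherk

/-- In an `n`-zero-free sequence whose most frequent term is `0`, zero-sum subsequences have length
less than `n`. -/
theorem NZeroFree.card_lt {n : ℕ} [NeZero n] {γ : Multiset (ZMod n)} (hγ : NZeroFree n γ)
    (hmax : ∀ x, γ.count x ≤ γ.count 0) (R : Multiset (ZMod n)) (hR : R ≤ γ) (hsum : R.sum = 0) :
    R.card < n := by
  induction hr : R.card using Nat.strong_induction_on generalizing R with
  | _ r ih =>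
  subst hr
  by_contra hge
  push Not at hge
  rcases hge.eq_or_lt with heq | hlt
  · exact hγ R hR heq.symm hsum
  by_cases h0 : (0 : ZMod n) ∈ R
  · have hc := Multiset.card_erase_of_mem h0
    have hs : (R.erase 0).sum = 0 := by
      rw [← Multiset.cons_erase h0, Multiset.sum_cons, zero_add] at hsum
      exact hsum
    have := ih (R.erase 0).card (by rw [hc]; exact Nat.pred_lt (by omega)) (R.erase 0)
      ((Multiset.erase_le _ _).trans hR) hs rfl
    rw [hc] at this
    have : R.card.pred = R.card - 1 := rfl
    omega
  · obtain ⟨t, ht, htc, hts, ht0⟩ := exists_short_zero_sum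
      (fun x => (Multiset.count_le_of_le x hR).trans (hmax x)) (by rw [ZMod.card]; exact hge)
    have hpos := Multiset.card_pos.2 ht0
    have hc := Multiset.card_sub ht
    have hle := Multiset.card_le_card ht
    have hs : (R - t).sum = 0 := by
      have := congrArg Multiset.sum (Multiset.sub_add_cancel ht)
      rwa [Multiset.sum_add, hts, add_zero, hsum] at this
    have hlt' := ih (R - t).card (by omega) (R - t) ((Multiset.sub_le_self _ _).trans hR) hs rfl
    -- Enough zeros exist for the padding: `n - (R - t).card < t.card ≤ γ.count 0`.
    refine hγ (R - t + Multiset.replicate (n - (R - t).card) 0) ?_ ?_ ?_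
    · rw [Multiset.le_iff_count]
      intro x
      rw [Multiset.count_add, Multiset.count_replicate, Multiset.count_sub]
      have := Multiset.count_le_of_le x hR
      split_ifs with hx
      · subst hx
        rw [Multiset.count_eq_zero_of_notMem h0]
        omega
      · omega
    · rw [Multiset.card_add, Multiset.card_replicate]
      omega
    · simp [hs]

theorem Multiset.exists_le_of_le_map {α β : Type*} {f : α → β} {s : Multiset α} :
    ∀ {t : Multiset β}, t ≤ s.map f → ∃ r ≤ s, r.map f = t := by
  classical
  induction s using Multiset.induction_on with
  | empty => intro t ht; exact ⟨0, le_rfl, by simpa [eq_comm] using ht⟩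
  | cons a s ih =>
    intro t ht
    rw [Multiset.map_cons, ← Multiset.mem_powerset, Multiset.powerset_cons, Multiset.mem_add] at ht
    rcases ht with ht | ht
    · obtain ⟨r, hr, rfl⟩ := ih (Multiset.mem_powerset.1 ht)
      exact ⟨r, hr.trans (Multiset.le_cons_self _ _), rfl⟩
    · obtain ⟨t', ht', rfl⟩ := Multiset.mem_map.1 ht
      obtain ⟨r, hr, rfl⟩ := ih (Multiset.mem_powerset.1 ht')
      exact ⟨a ::ₘ r, (Multiset.cons_le_cons_iff a).2 hr, Multiset.map_cons _ _ _⟩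

/-! ### Subsums of positive integers with small average -/

section NatMultiset

theorem Multiset.card_le_sum_of_pos {M : Multiset ℕ} (hM : ∀ m ∈ M, 0 < m) : M.card ≤ M.sum := by
  simpa using Multiset.card_nsmul_le_sum (a := 1) (s := M) fun m hm => hM m hm

theorem Multiset.two_mul_card_le_sum_add_count_one (M : Multiset ℕ) (hM : ∀ m ∈ M, 0 < m) :
    2 * M.card ≤ M.sum + M.count 1 := by
  induction M using Multiset.induction_on with
  | empty => simp
  | cons a M ih =>
    have ha := hM a (Multiset.mem_cons_self _ _)
    have := ih fun m hm => hM m (Multiset.mem_cons_of_mem hm)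
    rw [Multiset.card_cons, Multiset.sum_cons, Multiset.count_cons]
    split_ifs <;> omega

/-- Positive integers with sum less than twice their number represent every integer up to their
sum. -/
theorem Multiset.exists_le_sum_eq (M : Multiset ℕ) : (∀ m ∈ M, 0 < m) → M.sum + 1 ≤ 2 * M.card →
    ∀ x ≤ M.sum, ∃ R ≤ M, R.sum = x := by
  induction M using Multiset.strongInductionOn with
  | ih M ih =>
  intro hM hs x hx
  by_cases h : ∃ d ∈ M, 2 ≤ d
  · obtain ⟨d, hd, hd2⟩ := h
    obtain ⟨M, rfl⟩ := Multiset.exists_cons_of_mem hd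
    have hM' : ∀ m ∈ M, 0 < m := fun m hm => hM m (Multiset.mem_cons_of_mem hm)
    have hc := Multiset.card_le_sum_of_pos hM'
    rw [Multiset.sum_cons] at hs hx
    rw [Multiset.card_cons] at hs
    have ih := ih M (Multiset.lt_cons_self _ _) hM' (by omega)
    by_cases hxM : x ≤ M.sum
    · obtain ⟨R, hR, rfl⟩ := ih x hxM
      exact ⟨R, hR.trans (Multiset.le_cons_self _ _), rfl⟩
    -- The hypothesis forces `d ≤ M.sum + 1`, so the ranges of sums without and with `d` leave no
    -- gap.
    · obtain ⟨R, hR, hRx⟩ := ih (x - d) (by omega)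
      exact ⟨d ::ₘ R, (Multiset.cons_le_cons_iff d).2 hR, by rw [Multiset.sum_cons]; omega⟩
  · push Not at h
    have hrep : M = Multiset.replicate M.card 1 :=
      Multiset.eq_replicate_card.2 fun m hm => by have := hM m hm; have := h m hm; omega
    refine ⟨Multiset.replicate x 1, ?_, by simp⟩
    rw [hrep] at hx ⊢
    exact Multiset.replicate_mono _ (by simpa using hx)

theorem Multiset.exists_le_sum_eq_two_le_card (M : Multiset ℕ) : (∀ m ∈ M, 0 < m) →
    M.sum + 2 ≤ 2 * M.card → ∀ x ≤ M.sum, 2 ≤ x → ∃ R ≤ M, R.sum = x ∧ 2 ≤ R.card := by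
  induction M using Multiset.strongInductionOn with
  | ih M ih =>
  intro hM hs x hx hx2
  by_cases h : ∃ d ∈ M, 2 ≤ d
  · obtain ⟨d, hd, hd2⟩ := h
    obtain ⟨M, rfl⟩ := Multiset.exists_cons_of_mem hd
    have hM' : ∀ m ∈ M, 0 < m := fun m hm => hM m (Multiset.mem_cons_of_mem hm)
    have hc := Multiset.card_le_sum_of_pos hM'
    rw [Multiset.sum_cons] at hs hx
    rw [Multiset.card_cons] at hs
    by_cases hxM : x ≤ M.sum
    · obtain ⟨R, hR, hRx, hRc⟩ := ih M (Multiset.lt_cons_self _ _) hM' (by omega) x hxM hx2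
      exact ⟨R, hR.trans (Multiset.le_cons_self _ _), hRx, hRc⟩
    -- Here `d ≤ M.card ≤ M.sum < x`, so `d` alone does not make up `x`.
    · obtain ⟨R, hR, hRx⟩ := M.exists_le_sum_eq hM' (by omega) (x - d) (by omega)
      refine ⟨d ::ₘ R, (Multiset.cons_le_cons_iff d).2 hR, by rw [Multiset.sum_cons]; omega, ?_⟩
      have : R ≠ 0 := by
        rintro rfl
        rw [Multiset.sum_zero] at hRx
        omega
      have := Multiset.card_pos.2 this
      rw [Multiset.card_cons]
      omega
  · push Not at h
    have hrep : M = Multiset.replicate M.card 1 :=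
      Multiset.eq_replicate_card.2 fun m hm => by have := hM m hm; have := h m hm; omega
    refine ⟨Multiset.replicate x 1, ?_, by simp, by simpa using hx2⟩
    rw [hrep] at hx ⊢
    exact Multiset.replicate_mono _ (by simpa using hx)

/-- Among positive integers, each at most `b`, with sum exceeding `b`, a minimal subfamily with sum
exceeding `b` has `|J| + Σ J ≤ 2 (b + 1)`. -/
theorem Multiset.exists_le_lt_sum_card_add_sum_le {b : ℕ} (N : Multiset ℕ) : (∀ m ∈ N, 0 < m) →
    (∀ m ∈ N, m ≤ b) → b < N.sum →
    ∃ J ≤ N, b < J.sum ∧ J.sum ≤ 2 * b ∧ J.card + J.sum ≤ 2 * (b + 1) := by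
  induction N using Multiset.strongInductionOn with
  | ih N ih =>
  intro hN hb hs
  by_cases h : ∃ y ∈ N, b < (N.erase y).sum
  · obtain ⟨y, hy, hlt⟩ := h
    obtain ⟨J, hJ, h1⟩ := ih (N.erase y) (Multiset.erase_lt.2 hy)
      (fun m hm => hN m (Multiset.mem_of_mem_erase hm))
      (fun m hm => hb m (Multiset.mem_of_mem_erase hm)) hlt
    exact ⟨J, hJ.trans (Multiset.erase_le _ _), h1⟩
  · push Not at h
    refine ⟨N, le_rfl, hs, ?_⟩
    obtain ⟨y, hy⟩ : ∃ y, y ∈ N := Multiset.exists_mem_of_ne_zero (by rintro rfl; simp at hs)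
    obtain ⟨N, rfl⟩ := Multiset.exists_cons_of_mem hy
    have h1 := h y (Multiset.mem_cons_self _ _)
    rw [Multiset.erase_cons_head] at h1
    have hyb := hb y (Multiset.mem_cons_self _ _)
    rw [Multiset.sum_cons] at hs
    -- A minimal family has two terms `y`, `z`; adding the bounds for the sums without `y` and
    -- without `z` counts the remaining terms twice.
    obtain ⟨z, hz⟩ : ∃ z, z ∈ N := Multiset.exists_mem_of_ne_zero (by
      rintro rfl
      simp at hs
      omega)
    obtain ⟨N, rfl⟩ := Multiset.exists_cons_of_mem hz
    have h2 := h z (Multiset.mem_cons_of_mem hz)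
    rw [Multiset.cons_swap, Multiset.erase_cons_head] at h2
    have h3 := Multiset.card_le_sum_of_pos (M := N)
      fun m hm => hN m (Multiset.mem_cons_of_mem (Multiset.mem_cons_of_mem hm))
    simp only [Multiset.sum_cons, Multiset.card_cons] at *
    omega

end NatMultiset

/-! ### Exchange argument in the normal form -/

/-- The normal form: `M` consists of positive integers with sum less than `n`, and `W` is a longest
zero-sum subsequence of `M + W` in `ZMod n`. -/
theorem two_mul_le_add_count_one {n k u : ℕ} [NeZero n] {M : Multiset ℕ} {W : Multiset (ZMod n)}
    (hM : ∀ m ∈ M, 0 < m) (hs : M.sum < n) (hk : n < 2 * k) (hu : u + W.card < n)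
    (hcard : u + M.card + W.card = n - 1 + k) (hW0 : 0 ∉ W) (hW : W.sum = 0)
    (hmax : ∀ R ≤ M.map (Nat.cast : ℕ → ZMod n) + W, R.sum = 0 → R.card ≤ W.card) :
    2 * k ≤ u + (M.map (Nat.cast : ℕ → ZMod n) + W).count 1 ∧
      0 < (M.map (Nat.cast : ℕ → ZMod n) + W).count 1 := by
  have hM1 := M.two_mul_card_le_sum_add_count_one hM
  have hMs := Multiset.card_le_sum_of_pos hM
  -- exchanging part of `W` for part of `M` cannot lengthen `W`
  have hswap : ∀ J ≤ W, ∀ R ≤ M, (R.sum : ZMod n) = J.sum → R.card ≤ J.card := by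
    intro J hJ R hR hsum
    have h1 := hmax (R.map (Nat.cast : ℕ → ZMod n) + (W - J))
      (add_le_add (Multiset.map_le_map hR) (Multiset.sub_le_self _ _)) (by
        rw [Multiset.sum_add, ← Nat.cast_multiset_sum, hsum, ← Multiset.sum_add, add_comm,
          Multiset.sub_add_cancel hJ, hW])
    rw [Multiset.card_add, Multiset.card_map, Multiset.card_sub hJ] at h1
    have := Multiset.card_le_card hJ
    omega
  have hbig : ∀ x ∈ W, x ≠ 1 → M.sum < x.val := by
    intro x hx hx1
    by_contra hle
    push Not at hle
    have hx0 : x ≠ 0 := fun h => hW0 (h ▸ hx)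
    have hv0 : x.val ≠ 0 := (ZMod.val_ne_zero x).2 hx0
    have hv1 : x.val ≠ 1 := by
      intro h
      apply hx1
      rw [← ZMod.natCast_zmod_val x, h, Nat.cast_one]
    obtain ⟨R, hR, hRx, hRc⟩ := M.exists_le_sum_eq_two_le_card hM (by omega) x.val hle (by omega)
    have := hswap {x} (by simpa using hx) R hR (by rw [hRx]; simp)
    rw [Multiset.card_singleton] at this
    omega
  set N : Multiset ℕ := (W.filter (· ≠ 1)).map fun x => (-x).val with hN
  have hNW : N.map (fun y : ℕ => -(y : ZMod n)) = W.filter (· ≠ 1) := by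
    rw [hN, Multiset.map_map]
    simp
  have hNmem : ∀ y ∈ N, 0 < y ∧ y ≤ n - 1 - M.sum := by
    intro y hy
    obtain ⟨x, hx, rfl⟩ := Multiset.mem_map.1 hy
    obtain ⟨hxW, hx1⟩ := Multiset.mem_filter.1 hx
    have hx0 : x ≠ 0 := fun h => hW0 (h ▸ hxW)
    have : NeZero x := ⟨hx0⟩
    have := hbig x hxW hx1
    have := ZMod.val_lt x
    rw [ZMod.val_neg_of_ne_zero]
    omega
  have hsumneg : ∀ J : Multiset ℕ, (J.map fun y : ℕ => -(y : ZMod n)).sum = -(J.sum : ZMod n) := by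
    intro J
    rw [Nat.cast_multiset_sum]
    exact Multiset.sum_map_neg
  have hNsum : N.sum ≤ n - 1 - M.sum := by
    by_contra hlt
    push Not at hlt
    obtain ⟨J, hJ, h1, h2, h3⟩ := N.exists_le_lt_sum_card_add_sum_le (fun y hy => (hNmem y hy).1)
      (fun y hy => (hNmem y hy).2) hlt
    -- Dropping `e` ones from `M` leaves sum `n - J.sum`, that of the terms `-y`, and more than
    -- `J.card` terms: a forbidden exchange.
    obtain ⟨e, he⟩ : ∃ e, e = M.sum + J.sum - n := ⟨_, rfl⟩
    have hle : Multiset.replicate e 1 ≤ M := Multiset.le_count_iff_replicate_le.1 (by omega)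
    have hRsum : (M - Multiset.replicate e 1).sum + e = M.sum := by
      have := congrArg Multiset.sum (Multiset.sub_add_cancel hle)
      simpa using this
    have := hswap (J.map fun y : ℕ => -(y : ZMod n))
      ((Multiset.map_le_map hJ).trans (hNW ▸ Multiset.filter_le _ _))
      (M - Multiset.replicate e 1) (Multiset.sub_le_self _ _) (by
        rw [hsumneg, eq_neg_iff_add_eq_zero, ← Nat.cast_add, ZMod.natCast_eq_zero_iff]
        exact ⟨1, by omega⟩)
    rw [Multiset.card_map, Multiset.card_sub hle, Multiset.card_replicate] at this
    omega
  have hsplit : W = Multiset.replicate (W.count 1) 1 + N.map fun y : ℕ => -(y : ZMod n) := by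
    rw [hNW, ← Multiset.filter_eq' W 1]
    exact (Multiset.filter_add_not _ _).symm
  have hc := congrArg Multiset.card hsplit
  rw [Multiset.card_add, Multiset.card_replicate, Multiset.card_map] at hc
  -- Both sides are below `n`, so the congruence from `W.sum = 0` is an equality.
  have hp : W.count 1 = N.sum := by
    have h1 := congrArg Multiset.sum hsplit
    rw [hW, Multiset.sum_add, hsumneg, Multiset.sum_replicate, nsmul_one, eq_comm,
      ← sub_eq_add_neg, sub_eq_zero, ZMod.natCast_eq_natCast_iff'] at h1
    rwa [Nat.mod_eq_of_lt (by omega), Nat.mod_eq_of_lt (by omega)] at h1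
  have hNc := Multiset.card_le_sum_of_pos fun y hy => (hNmem y hy).1
  have hMc : M.count 1 ≤ (M.map (Nat.cast : ℕ → ZMod n)).count 1 := by
    rw [← Nat.cast_one (R := ZMod n)]
    obtain ⟨c, hc⟩ : ∃ c, c = M.count 1 := ⟨_, rfl⟩
    rw [← hc, Multiset.le_count_iff_replicate_le, ← Multiset.map_replicate]
    exact Multiset.map_le_map (Multiset.le_count_iff_replicate_le.1 hc.le)
  rw [Multiset.count_add]
  omega

theorem NZeroFree.map_add_right {n : ℕ} {γ : Multiset (ZMod n)} (h : NZeroFree n γ) (c : ZMod n) :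
    NZeroFree n (γ.map (· + c)) := by
  intro τ hτ hc hsum
  obtain ⟨r, hr, rfl⟩ := Multiset.exists_le_of_le_map hτ
  rw [Multiset.card_map] at hc
  refine h r hr hc ?_
  rw [Multiset.sum_map_add] at hsum
  simpa [hc] using hsum

/-- The largest multiplicity and another one have sum at least `2 * k`, in the normalized case
where `0` is the most frequent term. -/
theorem NZeroFree.exists_two_mul_le_count_add_count {n k : ℕ} [NeZero n] {γ : Multiset (ZMod n)}
    (hγ : NZeroFree n γ) (hk : n < 2 * k) (hcard : γ.card = n - 1 + k)
    (hmax : ∀ x, γ.count x ≤ γ.count 0) :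
    ∃ g ∈ γ, g ≠ 0 ∧ 2 * k ≤ γ.count 0 + γ.count g := by
  set T := γ.filter (· ≠ 0) with hT
  have hγT : γ = Multiset.replicate (γ.count 0) 0 + T := by
    rw [hT, ← Multiset.filter_eq' γ 0]
    exact (Multiset.filter_add_not _ _).symm
  have hγc := congrArg Multiset.card hγT
  rw [Multiset.card_add, Multiset.card_replicate, hcard] at hγc
  -- a longest zero-sum subsequence of the nonzero terms
  obtain ⟨W, hWmem, hWmax⟩ := Finset.exists_max_image
    ((T.powerset.filter fun R => R.sum = 0).toFinset) Multiset.card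
    ⟨0, by simp⟩
  simp only [Multiset.mem_toFinset, Multiset.mem_filter, Multiset.mem_powerset] at hWmem hWmax
  obtain ⟨hWT, hWsum⟩ := hWmem
  have hu : γ.count 0 + W.card < n := by
    have := hγ.card_lt hmax (Multiset.replicate (γ.count 0) 0 + W)
      (by conv_rhs => rw [hγT]
          exact add_le_add le_rfl hWT) (by simp [hWsum])
    simpa using this
  have hFW := Multiset.sub_add_cancel hWT
  set F := T - W with hF
  have hFc := congrArg Multiset.card hFW
  rw [Multiset.card_add] at hFc
  have hfree : ZeroFree F := by
    intro t ht hts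
    have := hWmax (t + W) ⟨hFW ▸ add_le_add ht le_rfl, by simp [hts, hWsum]⟩
    rw [Multiset.card_add] at this
    exact Multiset.card_eq_zero.1 (by omega)
  obtain ⟨g, M, hM, hFM, hord, -⟩ := hfree.exists_eq_map_nsmul F (by
    have := Finset.card_le_univ (subsums F)
    rw [ZMod.card] at this
    omega)
  have hMc : M.card = F.card := by rw [hFM, Multiset.card_map]
  have hMs := Multiset.card_le_sum_of_pos hM
  have hlt : M.sum < addOrderOf g := by
    by_contra hle
    exact hord _ (addOrderOf_pos g) (not_lt.1 hle) (addOrderOf_nsmul_eq_zero g)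
  have hdvd : addOrderOf g ∣ n := by
    simpa [ZMod.card] using addOrderOf_dvd_card (x := g)
  have hordn : addOrderOf g = n := by
    obtain ⟨c, hc⟩ := hdvd
    -- The order exceeds `M.sum ≥ F.card ≥ k`.
    have h1 : n < 2 * addOrderOf g := by omega
    have hc2 : c < 2 := by
      by_contra h2
      have := Nat.mul_le_mul_left (addOrderOf g) (not_lt.1 h2)
      omega
    have hn0 := NeZero.ne n
    interval_cases c <;> omega
  obtain ⟨j, hj⟩ : ∃ j : ℕ, (j : ZMod n) * g = 1 := by
    have hn0 := NeZero.ne n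
    rw [← ZMod.natCast_zmod_val g, ZMod.addOrderOf_coe _ hn0] at hordn
    have hcop : g.val.Coprime n := by
      rw [Nat.coprime_comm]
      exact (Nat.div_eq_self.1 hordn).resolve_left hn0
    refine ⟨(g⁻¹).val, ?_⟩
    have := ZMod.coe_mul_inv_eq_one _ hcop
    rwa [ZMod.natCast_zmod_val, mul_comm, ← ZMod.natCast_zmod_val g⁻¹] at this
  set f : ZMod n → ZMod n := fun x => (j : ZMod n) * x with hf
  have hgf : ∀ x, g * f x = x := fun x => by
    rw [hf]
    linear_combination x * hj
  have hinj : Function.Injective f := fun x y hxy => by rw [← hgf x, hxy, hgf]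
  have hFf : F.map f = M.map (Nat.cast : ℕ → ZMod n) := by
    rw [hFM, Multiset.map_map]
    refine Multiset.map_congr rfl fun m _ => ?_
    simp only [Function.comp_apply, hf, nsmul_eq_mul]
    linear_combination (m : ZMod n) * hj
  have hsumf : ∀ R : Multiset (ZMod n), (R.map f).sum = j * R.sum := fun R => by
    rw [hf, Multiset.sum_map_mul_left, Multiset.map_id']
  have key := two_mul_le_add_count_one (n := n) (k := k) (u := γ.count 0) (M := M) (W := W.map f)
    hM (by omega) hk (by simpa using hu) (by rw [Multiset.card_map]; omega) (by
      intro h0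
      obtain ⟨x, hx, hx0⟩ := Multiset.mem_map.1 h0
      have hx' : x = 0 := by rw [← hgf x, hx0, mul_zero]
      exact (Multiset.mem_filter.1 (Multiset.mem_of_le hWT hx)).2 hx')
    (by rw [hsumf, hWsum, mul_zero]) (by
      intro R hR hRs
      rw [← hFf, ← Multiset.map_add, hFW] at hR
      obtain ⟨R, hRT, rfl⟩ := Multiset.exists_le_of_le_map hR
      have hRs' : R.sum = 0 := by
        rw [← hgf R.sum, show f R.sum = 0 from (hsumf R).symm.trans hRs, mul_zero]
      simpa using hWmax R ⟨hRT, hRs'⟩)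
  rw [← hFf, ← Multiset.map_add, hFW, ← hj, Multiset.count_map_eq_count' f T hinj g] at key
  have hTγ : T.count g ≤ γ.count g := Multiset.count_le_of_le g (Multiset.filter_le _ _)
  exact ⟨g, Multiset.mem_of_le (Multiset.filter_le _ _) (Multiset.count_pos.1 key.2),
    (Multiset.mem_filter.1 (Multiset.count_pos.1 key.2)).2, by omega⟩

theorem NZeroFree.exists_pair {n k : ℕ} {γ : Multiset (ZMod n)} (hγ : NZeroFree n γ)
    (hk : n < 2 * k) (hkn : k < n) (hcard : γ.card = n - 1 + k) :
    ∃ a ∈ γ, ∃ b ∈ γ, a ≠ b ∧ 2 * k ≤ γ.count a + γ.count b := by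
  have : NeZero n := ⟨by omega⟩
  obtain ⟨x, hx⟩ := Multiset.card_pos_iff_exists_mem.1 (show 0 < γ.card by omega)
  obtain ⟨a, ha, hmax⟩ := Finset.exists_max_image γ.toFinset γ.count ⟨x, by simpa using hx⟩
  have hcount : ∀ y, (γ.map (· + -a)).count y = γ.count (y + a) := fun y => by
    rw [← Multiset.count_map_eq_count' (· + -a) γ (add_left_injective _) (y + a)]
    simp
  obtain ⟨g, hg, hg0, hle⟩ := (hγ.map_add_right (-a)).exists_two_mul_le_count_add_count hk
    (by simpa using hcard) (by
      intro y
      rw [hcount, hcount, zero_add]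
      by_cases hy : y + a ∈ γ
      · exact hmax _ (by simpa using hy)
      · rw [Multiset.count_eq_zero_of_notMem hy]
        exact Nat.zero_le _)
  rw [hcount, hcount, zero_add] at hle
  refine ⟨a, by simpa using ha, g + a, ?_, by simpa [eq_comm] using hg0, hle⟩
  rw [← Multiset.count_pos, hcount] at hg
  exact Multiset.count_pos.1 hg

/-! ### The extremal example -/

/-- The sequence `0^u 1^v 2^r (-1)^t` with `u + 2 * t < n` and `v + 2 * r < n` is `n`-zero-free. -/
theorem nZeroFree_replicate {n u v r t : ℕ} (hu : u + 2 * t < n) (hv : v + 2 * r < n) :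
    NZeroFree n (Multiset.replicate u 0 + Multiset.replicate v 1 + Multiset.replicate r 2 +
      Multiset.replicate t (-1)) := by
  intro τ hτ hc hsum
  set Γ : Multiset ℤ := Multiset.replicate u 0 + Multiset.replicate v 1 + Multiset.replicate r 2 +
      Multiset.replicate t (-1) with hΓ
  have hmap : Multiset.replicate u 0 + Multiset.replicate v 1 + Multiset.replicate r 2 +
      Multiset.replicate t (-1) = Γ.map (Int.cast : ℤ → ZMod n) := by
    simp [hΓ]
  rw [hmap] at hτ
  obtain ⟨σ, hσ, rfl⟩ := Multiset.exists_le_of_le_map hτ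
  rw [Multiset.card_map] at hc
  rw [← Int.cast_multiset_sum, ZMod.intCast_zmod_eq_zero_iff_dvd] at hsum
  have hmono : ∀ f : ℤ → ℤ, (∀ x, 0 ≤ f x) → (σ.map f).sum ≤ (Γ.map f).sum := by
    intro f hf
    obtain ⟨ρ, hρ⟩ := Multiset.le_iff_exists_add.1 hσ
    rw [hρ, Multiset.map_add, Multiset.sum_add]
    have : 0 ≤ (ρ.map f).sum := Multiset.sum_nonneg (by simpa using fun x _ => hf x)
    omega
  -- Lifted to integers, the sum `s` of `n` terms satisfies `s ≤ v + 2 * r < n` and `n - s ≤ u + 2 *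
  -- t < n`, so `0 < s < n`.
  have h1 := hmono (fun x => max x 0) (fun x => le_max_right _ _)
  have h2 := hmono (fun x => max (1 - x) 0) (fun x => le_max_right _ _)
  have h3 : σ.sum ≤ (σ.map fun x => max x 0).sum := by
    conv_lhs => rw [← Multiset.map_id' σ]
    exact Multiset.sum_map_le_sum_map _ _ fun x _ => le_max_left _ _
  have h4 : (σ.card : ℤ) - σ.sum ≤ (σ.map fun x => max (1 - x) 0).sum := by
    have : (σ.map fun x => 1 - x).sum = σ.card - σ.sum := by
      rw [Multiset.sum_map_sub]
      simp
    rw [← this]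
    exact Multiset.sum_map_le_sum_map _ _ fun x _ => le_max_left _ _
  simp [hΓ] at h1 h2
  have := Int.le_of_dvd (by omega) hsum
  omega

theorem exists_nZeroFree_count_add_count_le {n k : ℕ} (hk : n < 2 * k) (hkn : k < n) :
    ∃ γ : Multiset (ZMod n), NZeroFree n γ ∧ γ.card = n - 1 + k ∧
      ∀ a ∈ γ, ∀ b ∈ γ, a ≠ b → γ.count a + γ.count b ≤ 2 * k := by
  -- With `r + t = n - 1 - k` one gets `u + v = 2 * k`; balancing `r` and `t` keeps the other pairs
  -- below that.
  obtain ⟨r, hr⟩ : ∃ r, r = (n - 1 - k) / 2 := ⟨_, rfl⟩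
  obtain ⟨t, ht⟩ : ∃ t, t = n - 1 - k - r := ⟨_, rfl⟩
  obtain ⟨u, hu⟩ : ∃ u, u = n - 1 - 2 * t := ⟨_, rfl⟩
  obtain ⟨v, hv⟩ : ∃ v, v = n - 1 - 2 * r := ⟨_, rfl⟩
  refine ⟨_, nZeroFree_replicate (u := u) (v := v) (r := r) (t := t) (by omega) (by omega), ?_, ?_⟩
  · simp only [Multiset.card_add, Multiset.card_replicate]
    omega
  have ne : ∀ d : ℕ, 0 < d → d < n → (d : ZMod n) ≠ 0 := fun d hd hdn h0 =>
    absurd (Nat.le_of_dvd hd ((ZMod.natCast_eq_zero_iff d n).1 h0)) (by omega)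
  have h10 : (1 : ZMod n) ≠ 0 := by simpa using ne 1 one_pos (by omega)
  -- For `n ≤ 4` the terms `2` and `-1` do not occur; for larger `n` all four values are distinct.
  by_cases hn : n ≤ 4
  · obtain ⟨rfl, rfl⟩ : r = 0 ∧ t = 0 := by omega
    intro a ha b hb hab
    simp only [Multiset.replicate_zero, add_zero, Multiset.mem_add] at ha hb
    simp only [Multiset.replicate_zero, add_zero, Multiset.count_add, Multiset.count_replicate]
    rcases ha with ha | ha <;> rcases hb with hb | hb <;>
      rw [Multiset.eq_of_mem_replicate ha, Multiset.eq_of_mem_replicate hb] at hab ⊢ <;>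
      simp [h10, h10.symm] at hab ⊢ <;> omega
  · have h20 : (2 : ZMod n) ≠ 0 := by simpa using ne 2 two_pos (by omega)
    have h21 : (2 : ZMod n) ≠ 1 := fun h => h10 (by linear_combination h)
    have hm0 : (-1 : ZMod n) ≠ 0 := neg_ne_zero.2 h10
    have hm1 : (-1 : ZMod n) ≠ 1 := fun h => h20 (by linear_combination -h)
    have hm2 : (-1 : ZMod n) ≠ 2 := fun h => ne 3 (by omega) (by omega)
      (by push_cast; linear_combination -h)
    intro a ha b hb hab
    simp only [Multiset.mem_add] at ha hb
    simp only [Multiset.count_add, Multiset.count_replicate]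
    rcases ha with ((ha | ha) | ha) | ha <;> rcases hb with ((hb | hb) | hb) | hb <;>
      rw [Multiset.eq_of_mem_replicate ha, Multiset.eq_of_mem_replicate hb] at hab ⊢ <;>
      simp only [h10, h10.symm, h20, h20.symm, h21, h21.symm, hm0, hm0.symm, hm1, hm1.symm, hm2,
        hm2.symm, if_true, if_false, ne_eq, not_true_eq_false] at hab ⊢ <;> omega

theorem corollary4p2 (n k : ℕ) (hnk : (n : ℚ) / 2 < k) (hkn : k < n) :
    (∀ γ : Multiset (ZMod n), NZeroFree n γ → γ.card = n - 1 + k →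
      ∃ a ∈ γ, ∃ b ∈ γ, a ≠ b ∧ 2 * k ≤ γ.count a + γ.count b) ∧
    (∃ γ : Multiset (ZMod n), NZeroFree n γ ∧ γ.card = n - 1 + k ∧
      ∀ a ∈ γ, ∀ b ∈ γ, a ≠ b → γ.count a + γ.count b ≤ 2 * k) := by
  have hk : n < 2 * k := by
    rw [div_lt_iff₀ two_pos] at hnk
    have : (n : ℚ) < ((k * 2 : ℕ) : ℚ) := by push_cast; exact hnk
    have := Nat.cast_lt.1 this
    omega
  exact ⟨fun γ hγ hcard => hγ.exists_pair hk hkn hcard, exists_nZeroFree_count_add_count_le hk hkn⟩
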